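/- Let $q$ be a prime with $q\equiv 3 \pmod 4$ and put $n=(q+1)/2$. Order the $q+1$ points of the projective line $\mathbb P^1(\mathbb F_q)$, choose for each point $P$ a nonzero representative $\hat P\in\mathbb F_q^2$, and let $H_q$ be the $(q+1)\times(q+1)$ matrix with entries $(H_q)_{P,Q}=\chi(\det(\hat P,\hat Q))$, where $\chi(a)=1$ if $a$ is a square in $\mathbb F_q$ (including $a=0$) and $\chi(a)=-1$ otherwise. A configuration is a finite family of unit vectors in $\mathbb C^n$; two configurations are switching equivalent if one is obtained from the other by a unitary transformation, a reindexing, and multiplication of the vectors by unimodular scalars. A configuration $\Phi$ of $q+1$ vectors is called a Paley ETF if it is switching equivalent to a configuration with Gram matrix $I+\tfrac{i}{\sqrt q}(H_q-I)$, for some such choices of ordering and representatives. A projective unitary representation of a group $G$ on $\mathbb C^n$ is a map $\pi:G\to U(n)$ such that for all $g,g'$ one has $\pi(gg')=\alpha\,\pi(g)\pi(g')$ for some unimodular scalar $\alpha=\alpha(g,g')$; it is strict if it is a homomorphism; $\pi$ and $\pi'$ are equivalent if there is $Q\in U(n)$ such that for each $g$, $Q\pi(g)Q^*=\alpha_g\pi'(g)$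 for some unimodular $\alpha_g$. Let $D_n$ be the dihedral group of order $2n$. Then: 1. $H_q$ is a skew Hadamard matrix for all choices of ordering and representatives, i.e. it has entries $\pm1$, $H_qH_q^{\top}=(q+1)I$ and $H_q+H_q^{\top}=2I$. 2. Paley ETFs $\Phi=(\varphi_j)_{j}\subset\mathbb C^{n}$ exist, and each of them is an equiangular tight frame $\mathrm{ETF}(q+1,(q+1)/2)$: its $q+1$ vectors have norm $1$, there is $A>0$ with $\sum_j|\langle x,\varphi_j\rangle|^2=A\|x\|^2$ for all $x\in\mathbb C^n$, and $|\langle\varphi_i,\varphi_j\rangle|$ is the same for all $i\ne j$. 3. Each Paley ETF is a genuinely projective dihedral frame: it is switching equivalent to an orbit $(\pi(g)v)_{g\in D_n}$, where $v\in\mathbb C^n$ is a unit vector and $\pi:D_n\to U(n)$ is a projective unitary representation that is not equivalent to a strict one; and it is not switching equivalent to any orbit $(\pi(g)v)_{g\in D_n}$ of a unit vector $v$ under a projective unitary representation $\pi:D_n\to U(n)$ that is equivalent to a strict one. -/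

import Mathlib

noncomputable section

namespace PaleyDihedral

/-- The Hilbert space `ℂⁿ` with its standard Hermitian inner product. -/
abbrev E (n : ℕ) : Type := EuclideanSpace ℂ (Fin n)

/-- The unitary group `U(n)`, as the group of linear isometries of `ℂⁿ`. -/
abbrev U (n : ℕ) : Type := E n ≃ₗᵢ[ℂ] E n

/-! ### Configurations and equiangular tight frames -/

/-- `φ` is an `ETF(N, n)`: `N` unit vectors in `ℂⁿ` that form a tight frame and whose pairwise
inner products all have the same modulus. -/
structure IsETF {N n : ℕ} (φ : Fin N → E n) : Prop where
  unit_norm : ∀ i, ‖φ i‖ = 1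
  tight : ∃ A : ℝ, 0 < A ∧ ∀ x : E n, ∑ j, ‖inner ℂ x (φ j)‖ ^ 2 = A * ‖x‖ ^ 2
  equiangular : ∃ c : ℝ, ∀ i j, i ≠ j → ‖inner ℂ (φ i) (φ j)‖ = c

/-- Switching equivalence: `ψ` arises from `φ` by a unitary transformation, a reindexing and a
change of the phases of the vectors. -/
def SwitchingEquiv {n : ℕ} {ι κ : Type*} (φ : ι → E n) (ψ : κ → E n) : Prop :=
  ∃ (σ : ι ≃ κ) (c : ι → ℂ) (Q : U n),
    (∀ i, ‖c i‖ = 1) ∧ ∀ i, ψ (σ i) = c i • Q (φ i)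

/-! ### Projective unitary representations -/

/-- `π(g g') = α π(g) π(g')` for some unimodular scalar `α` (depending on `g` and `g'`). -/
def IsProjRep {G : Type*} [Group G] {n : ℕ} (π : G → U n) : Prop :=
  ∀ g g' : G, ∃ α : ℂ, ‖α‖ = 1 ∧ ∀ x, π (g * g') x = α • π g (π g' x)

/-- Equivalence of projective representations: `Q π(g) Q* = α π'(g)` for a unitary `Q` and some
unimodular scalar `α` (depending on `g`). -/
def ProjEquiv {G : Type*} {n : ℕ} (π π' : G → U n) : Prop :=
  ∃ Q : U n, ∀ g, ∃ α : ℂ, ‖α‖ = 1 ∧ ∀ x, Q (π g (Q.symm x)) = α • π' g x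

/-- `π` is equivalent, as a projective representation, to a strict unitary representation. -/
def EquivToStrict {G : Type*} [Group G] {n : ℕ} (π : G → U n) : Prop :=
  ∃ ρ : G →* U n, ProjEquiv π ρ

/-! ### Dihedral configurations in `ℂⁿ` (`DihedralGroup n` is the dihedral group of order `2n`) -/

/-- Up to switching equivalence, `φ` is the orbit `(π(g) v)`, `g ∈ Dₙ`, of a unit vector `v` under
a projective unitary representation `π` of `Dₙ` that is not equivalent to a strict one. -/
def IsGenuineProjectiveDihedral {N n : ℕ} (φ : Fin N → E n) : Prop :=
  ∃ (π : DihedralGroup n → U n) (v : E n),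
    IsProjRep π ∧ ¬ EquivToStrict π ∧ ‖v‖ = 1 ∧ SwitchingEquiv (fun g => π g v) φ

/-- Up to switching equivalence, `φ` is the orbit `(π(g) v)`, `g ∈ Dₙ`, of a unit vector `v` under
a projective unitary representation `π` of `Dₙ` that is equivalent to a strict one. -/
def IsStrictDihedral {N n : ℕ} (φ : Fin N → E n) : Prop :=
  ∃ (π : DihedralGroup n → U n) (v : E n),
    IsProjRep π ∧ EquivToStrict π ∧ ‖v‖ = 1 ∧ SwitchingEquiv (fun g => π g v) φ

/-! ### Skew Hadamard matrices and the Paley ETF -/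

/-- A skew Hadamard matrix: `±1` entries, `H Hᵀ = N I` and `H + Hᵀ = 2 I`. -/
structure IsSkewHadamard {N : ℕ} (H : Matrix (Fin N) (Fin N) ℤ) : Prop where
  entries : ∀ i j, H i j = 1 ∨ H i j = -1
  hadamard : H * H.transpose = (N : ℤ) • (1 : Matrix (Fin N) (Fin N) ℤ)
  skew : H + H.transpose = (2 : ℤ) • (1 : Matrix (Fin N) (Fin N) ℤ)

/-- The matrix `I + (i / √(N - 1)) (H - I)`. -/
def skewGram {N : ℕ} (H : Matrix (Fin N) (Fin N) ℤ) : Matrix (Fin N) (Fin N) ℂ :=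
  1 + (Complex.I / (Real.sqrt ((N : ℝ) - 1) : ℂ)) • (H.map (fun z : ℤ => (z : ℂ)) - 1)

/-- The plane `𝔽_q²`. -/
abbrev Plane (q : ℕ) : Type := Fin 2 → ZMod q

/-- The projective line over `𝔽_q`. -/
abbrev ProjLine (q : ℕ) [Fact q.Prime] : Type := Projectivization (ZMod q) (Plane q)

/-- `r` chooses a nonzero representative vector of each point of the projective line. -/
def IsLift {q : ℕ} [Fact q.Prime] (r : ProjLine q → Plane q) : Prop :=
  ∀ P, ∃ h : r P ≠ 0, Projectivization.mk (ZMod q) (r P) h = P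

/-- The determinant form on `𝔽_q²`. -/
def detForm {q : ℕ} (x y : Plane q) : ZMod q := x 0 * y 1 - x 1 * y 0

open Classical in
/-- The quadratic character of `𝔽_q`, with the convention that its value at `0` is `1`. -/
def paleySign {q : ℕ} (a : ZMod q) : ℤ := if ∃ x : ZMod q, a = x ^ 2 then 1 else -1

/-- The Paley matrix `H_q`, for an ordering `e` of the points of the projective line and a choice
`r` of representative vectors. -/
def paleyHadamard {q : ℕ} [Fact q.Prime] (e : Fin (q + 1) ≃ ProjLine q)
    (r : ProjLine q → Plane q) : Matrix (Fin (q + 1)) (Fin (q + 1)) ℤ :=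
  Matrix.of fun i j => paleySign (detForm (r (e i)) (r (e j)))

/-- `φ` represents the Paley ETF (which is defined only up to switching equivalence): `φ` is
switching equivalent to a configuration whose Gram matrix is `I + (i / √q) (H_q - I)`. -/
def IsPaleyETF {q n : ℕ} [Fact q.Prime] (φ : Fin (q + 1) → E n) : Prop :=
  ∃ (e : Fin (q + 1) ≃ ProjLine q) (r : ProjLine q → Plane q) (ψ : Fin (q + 1) → E n),
    IsLift r ∧ Matrix.gram ℂ ψ = skewGram (paleyHadamard e r) ∧ SwitchingEquiv ψ φ

end PaleyDihedral

end

/-!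
Write `χ` for the quadratic character of `𝔽_q`, so that `H_q = 1 + S` with
`S_{PQ} = χ(det(P̂, Q̂))`. As `χ(-1) = -1`, the matrix `S` is skew. Its rows are orthogonal: in the
coordinates `z ↦ (det(x, z), det(y, z))` of the plane, the inner product of two rows is up to the
factor `q - 1` a product of two complete sums of `χ` (`sum_quadraticChar_detForm`). Hence
`S Sᵀ = q`, and `G = 1 + (i/√q) S` is Hermitian with `G² = 2G` and trace `q + 1 = 2n`. Such a matrix
is the Gram matrix of vectors of `ℂⁿ` (`exists_gram_eq`), and any such vectors have frame operator
`2` (`sum_inner_smul_eq`).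

*No strict dihedral orbit.* Triple products `⟨φ_i, φ_j⟩⟨φ_j, φ_k⟩⟨φ_k, φ_i⟩` are invariants of
switching equivalence up to reindexing. For a Paley ETF they are nonzero and purely imaginary at
distinct indices. For the orbit of `v` under a strict representation `ρ` the matrix coefficient
`⟨v, ρ(g) v⟩` is real at every involution `g`, so the triple products at three elements of a Klein
four-group are real. As `n` is even, `D_n` contains such a group
(`not_isStrictDihedral_of_gram_eq`).

*A projective dihedral orbit.* Index the frame by all nonzero vectors of the plane, by letting
scalars act through `χ`. The inner products then depend only on the values `χ(det(x, y))`, so a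
linear map of the plane whose determinant is a nonzero square induces a unitary of `ℂⁿ`
(`IsPaleySystem.inner_comp`, `exists_unitary_of_inner_eq`). Identify the plane with the field
`𝔽_q[i]`, and let `ω` generate its multiplicative group. The points of the projective line are the
classes of the powers of `ω`, with exponents modulo `q + 1 = 2n` (`zpow_eq_smul_zpow_iff`). The
maps `x ↦ ω^(2i) x` and `x ↦ ω^(1-2i) x̄` have square determinants, because the norm of `ω` and the
determinant `-1` of the conjugation are both non-squares. Modulo scalars they form a dihedral group
of order `2n`, which acts regularly on the projective line (`dihedralMap_mul`,
`dihedralMap_one_injective`). The central rotation `x ↦ ω^n x` anticommutes with the reflections,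
since `ω^(n(q-1)) = -1`. In a projective representation equivalent to a strict one commuting
elements of the group act by commuting operators, so the representation is genuinely projective
(`isGenuineProjectiveDihedral_of_gram_eq`).
-/

namespace PaleyDihedral

/-! ### The determinant form and representatives of projective points -/

section Determinant

variable {q : ℕ} [Fact q.Prime]

theorem detForm_self (x : Plane q) : detForm x x = 0 := by
  simp only [detForm]; ring

theorem detForm_swap (x y : Plane q) : detForm y x = -detForm x y := by
  simp only [detForm]; ring

theorem detForm_smul_left (c : ZMod q) (x y : Plane q) :
    detForm (c • x) y = c * detForm x y := by
  simp only [detForm, Pi.smul_apply, smul_eq_mul]; ring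

theorem detForm_smul_right (c : ZMod q) (x y : Plane q) :
    detForm x (c • y) = c * detForm x y := by
  simp only [detForm, Pi.smul_apply, smul_eq_mul]; ring

theorem exists_smul_of_detForm_eq_zero {x y : Plane q} (hx : x ≠ 0) (h : detForm x y = 0) :
    ∃ c : ZMod q, y = c • x := by
  simp only [detForm] at h
  by_cases h0 : x 0 = 0
  · have h1 : x 1 ≠ 0 := fun h1 => hx (by ext i; fin_cases i <;> simp [h0, h1])
    refine ⟨y 1 / x 1, ?_⟩
    have : y 0 = 0 := by
      have : x 1 * y 0 = 0 := by rw [h0] at h; linear_combination -h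
      exact (mul_eq_zero.1 this).resolve_left h1
    ext i; fin_cases i
    · simp [h0, this]
    · simp [h1]
  · refine ⟨y 0 / x 0, ?_⟩
    ext i; fin_cases i
    · simp [h0]
    · simp only [Fin.mk_one, Pi.smul_apply, smul_eq_mul]
      field_simp
      linear_combination h

theorem IsLift.ne_zero {r : ProjLine q → Plane q} (hr : IsLift r) (P : ProjLine q) : r P ≠ 0 :=
  (hr P).1

theorem IsLift.eq_of_smul {r : ProjLine q → Plane q} (hr : IsLift r) {P Q : ProjLine q}
    {c : ZMod q} (h : r Q = c • r P) : Q = P := by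
  obtain ⟨hP, hP'⟩ := hr P
  obtain ⟨hQ, hQ'⟩ := hr Q
  rw [← hP', ← hQ', Projectivization.mk_eq_mk_iff']
  exact ⟨c, h.symm⟩

theorem IsLift.detForm_eq_zero_iff {r : ProjLine q → Plane q} (hr : IsLift r)
    {P Q : ProjLine q} : detForm (r P) (r Q) = 0 ↔ P = Q := by
  constructor
  · intro h
    obtain ⟨c, hc⟩ := exists_smul_of_detForm_eq_zero (hr.ne_zero P) h
    exact (hr.eq_of_smul hc).symm
  · rintro rfl
    exact detForm_self _

theorem IsLift.exists_smul {r : ProjLine q → Plane q} (hr : IsLift r) {x : Plane q}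
    (hx : x ≠ 0) : ∃ (P : ProjLine q) (u : (ZMod q)ˣ), x = u • r P := by
  obtain ⟨hP, hP'⟩ := hr (Projectivization.mk (ZMod q) x hx)
  obtain ⟨u, hu⟩ := (Projectivization.mk_eq_mk_iff _ _ _ _ _).1 hP'.symm
  exact ⟨_, u, hu.symm⟩

theorem IsLift.smul_injective {r : ProjLine q → Plane q} (hr : IsLift r) {P Q : ProjLine q}
    {u v : (ZMod q)ˣ} (h : u • r P = v • r Q) : P = Q ∧ u = v := by
  have hPQ : P = Q := by
    refine hr.eq_of_smul (c := ((u⁻¹ * v : (ZMod q)ˣ) : ZMod q)) ?_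
    change r P = (u⁻¹ * v) • r Q
    rw [mul_smul, ← h, inv_smul_smul]
  subst hPQ
  refine ⟨rfl, Units.ext ?_⟩
  exact smul_left_injective (ZMod q) (hr.ne_zero P) h

noncomputable instance : Fintype (ProjLine q) := Fintype.ofFinite _

theorem card_projLine : Nat.card (ProjLine q) = q + 1 := by
  rw [Projectivization.card_of_finrank_two (ZMod q) (Plane q) (by simp)]
  simp

end Determinant

/-! ### The Paley matrix -/

section Character

variable {q : ℕ} [Fact q.Prime]

theorem paleySign_zero : paleySign (0 : ZMod q) = 1 := by
  simp only [paleySign]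
  exact if_pos ⟨0, by simp⟩

theorem paleySign_eq_quadraticChar {a : ZMod q} (ha : a ≠ 0) :
    paleySign a = quadraticChar (ZMod q) a := by
  have hiff : (∃ x : ZMod q, a = x ^ 2) ↔ IsSquare a := by
    simp only [IsSquare, sq]
  by_cases h : IsSquare a
  · rw [(quadraticChar_one_iff_isSquare ha).2 h, paleySign, if_pos (hiff.2 h)]
  · rw [quadraticChar_neg_one_iff_not_isSquare.2 h, paleySign, if_neg (fun h' => h (hiff.1 h'))]

theorem ringChar_zmod_ne_two (hq : q % 4 = 3) : ringChar (ZMod q) ≠ 2 := by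
  rw [ZMod.ringChar_zmod_n]; omega

theorem not_isSquare_neg_one (hq : q % 4 = 3) : ¬ IsSquare (-1 : ZMod q) := by
  rw [FiniteField.isSquare_neg_one_iff, ZMod.card]
  simpa using hq

theorem quadraticChar_neg (hq : q % 4 = 3) (a : ZMod q) :
    quadraticChar (ZMod q) (-a) = -quadraticChar (ZMod q) a := by
  have h : quadraticChar (ZMod q) (-1) = -1 :=
    quadraticChar_neg_one_iff_not_isSquare.2 (not_isSquare_neg_one hq)
  rw [neg_eq_neg_one_mul, map_mul, h, neg_one_mul]

theorem quadraticChar_mul_self {a : ZMod q} (ha : a ≠ 0) :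
    quadraticChar (ZMod q) a * quadraticChar (ZMod q) a = 1 := by
  rw [← sq, quadraticChar_sq_one ha]

/-- Distinct rows of the matrix of quadratic characters of determinants are orthogonal: in the
coordinates `(det(x, z), det(y, z))` of `z` the sum over the whole plane is a product of two
complete character sums, and it is `q - 1` times the sum over the projective line. -/
theorem sum_quadraticChar_detForm (hq : q % 4 = 3) {r : ProjLine q → Plane q} (hr : IsLift r)
    {x y : Plane q} (hxy : detForm x y ≠ 0) :
    ∑ P, quadraticChar (ZMod q) (detForm x (r P)) * quadraticChar (ZMod q) (detForm y (r P))
      = 0 := by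
  set f : Plane q → ℤ := fun z =>
    quadraticChar (ZMod q) (detForm x z) * quadraticChar (ZMod q) (detForm y z) with hf
  have hplane : ∑ z, f z = 0 := by
    have hinj : Function.Injective (fun z : Plane q => (detForm x z, detForm y z)) := by
      intro z w h
      obtain ⟨h1, h2⟩ := Prod.mk.inj h
      simp only [detForm] at h1 h2 hxy
      have e0 : (x 0 * y 1 - x 1 * y 0) * (z 0 - w 0) = 0 := by
        linear_combination y 0 * h1 - x 0 * h2
      have e1 : (x 0 * y 1 - x 1 * y 0) * (z 1 - w 1) = 0 := by
        linear_combination y 1 * h1 - x 1 * h2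
      ext i; fin_cases i
      · exact sub_eq_zero.1 ((mul_eq_zero.1 e0).resolve_left hxy)
      · exact sub_eq_zero.1 ((mul_eq_zero.1 e1).resolve_left hxy)
    have hbij := (Fintype.bijective_iff_injective_and_card _).2
      ⟨hinj, by simp [sq]⟩
    rw [Fintype.sum_bijective _ hbij f
      (fun p => quadraticChar (ZMod q) p.1 * quadraticChar (ZMod q) p.2) (fun _ => rfl),
      Fintype.sum_prod_type]
    simp only [← Finset.mul_sum, quadraticChar_sum_zero (ringChar_zmod_ne_two hq), mul_zero,
      Finset.sum_const_zero]
  have hscale (u : (ZMod q)ˣ) (z : Plane q) : f (u • z) = f z := by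
    have hu := quadraticChar_mul_self u.ne_zero
    simp only [hf, Units.smul_def, detForm_smul_right, map_mul]
    linear_combination quadraticChar (ZMod q) (detForm x z) *
      quadraticChar (ZMod q) (detForm y z) * hu
  have hbij : Function.Bijective (fun p : ProjLine q × (ZMod q)ˣ =>
      (⟨p.2 • r p.1, by simpa [smul_eq_zero_iff_eq] using hr.ne_zero p.1⟩ :
        {z : Plane q // z ≠ 0})) := by
    constructor
    · rintro ⟨P, u⟩ ⟨Q, v⟩ h
      obtain ⟨h1, h2⟩ := hr.smul_injective (Subtype.mk.inj h)
      exact Prod.ext h1 h2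
    · rintro ⟨z, hz⟩
      obtain ⟨P, u, h⟩ := hr.exists_smul hz
      exact ⟨(P, u), Subtype.ext h.symm⟩
  have hsub : ∑ z : {z : Plane q // z ≠ 0}, f z = 0 := by
    rw [← hplane, ← Finset.sum_subtype (Finset.univ.filter (· ≠ 0)) (by simp) f,
      Finset.sum_filter_of_ne]
    rintro z - hz rfl
    exact hz (by simp [hf, detForm])
  rw [← Fintype.sum_bijective _ hbij (fun p => f (r p.1)) _ (fun p => (hscale _ _).symm),
    Fintype.sum_prod_type] at hsub
  simp only [Finset.sum_const, ← Finset.smul_sum, Finset.card_univ] at hsub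
  exact (smul_eq_zero.1 hsub).resolve_left Fintype.card_ne_zero

theorem paleyHadamard_apply_of_ne {e : Fin (q + 1) ≃ ProjLine q} {r : ProjLine q → Plane q}
    (hr : IsLift r) {i j : Fin (q + 1)} (hij : i ≠ j) :
    paleyHadamard e r i j = quadraticChar (ZMod q) (detForm (r (e i)) (r (e j))) := by
  simp only [paleyHadamard, Matrix.of_apply]
  exact paleySign_eq_quadraticChar fun h => hij (e.injective (hr.detForm_eq_zero_iff.1 h))

theorem paleyHadamard_diag (e : Fin (q + 1) ≃ ProjLine q) (r : ProjLine q → Plane q)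
    (i : Fin (q + 1)) : paleyHadamard e r i i = 1 := by
  simp [paleyHadamard, detForm_self, paleySign_zero]

theorem paleyHadamard_eq (e : Fin (q + 1) ≃ ProjLine q) {r : ProjLine q → Plane q}
    (hr : IsLift r) (i j : Fin (q + 1)) : paleyHadamard e r i j =
      (1 : Matrix (Fin (q + 1)) (Fin (q + 1)) ℤ) i j +
        quadraticChar (ZMod q) (detForm (r (e i)) (r (e j))) := by
  rcases eq_or_ne i j with rfl | hij
  · simp [paleyHadamard_diag, detForm_self]
  · simp [paleyHadamard_apply_of_ne hr hij, hij]

theorem isSkewHadamard_paleyHadamard (hq : q % 4 = 3) (e : Fin (q + 1) ≃ ProjLine q)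
    {r : ProjLine q → Plane q} (hr : IsLift r) : IsSkewHadamard (paleyHadamard e r) := by
  have hskew : paleyHadamard e r + (paleyHadamard e r).transpose =
      (2 : ℤ) • (1 : Matrix (Fin (q + 1)) (Fin (q + 1)) ℤ) := by
    ext i j
    rw [Matrix.add_apply, Matrix.transpose_apply, paleyHadamard_eq e hr, paleyHadamard_eq e hr j i,
      detForm_swap, quadraticChar_neg hq, Matrix.smul_apply, Matrix.one_apply, Matrix.one_apply]
    simp only [eq_comm (a := j), smul_eq_mul]
    ring
  refine ⟨fun i j => ?_, ?_, hskew⟩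
  · rcases eq_or_ne i j with rfl | hij
    · exact Or.inl (paleyHadamard_diag e r i)
    · rw [paleyHadamard_apply_of_ne hr hij]
      exact quadraticChar_dichotomy fun h => hij (e.injective (hr.detForm_eq_zero_iff.1 h))
  · ext i j
    have hS : ∑ k, quadraticChar (ZMod q) (detForm (r (e i)) (r (e k))) *
        quadraticChar (ZMod q) (detForm (r (e j)) (r (e k))) = if i = j then (q : ℤ) else 0 := by
      rcases eq_or_ne i j with rfl | hij
      · have (k : Fin (q + 1)) : quadraticChar (ZMod q) (detForm (r (e i)) (r (e k))) *
            quadraticChar (ZMod q) (detForm (r (e i)) (r (e k))) = if i = k then 0 else 1 := by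
          rcases eq_or_ne i k with rfl | hik
          · simp [detForm_self]
          · rw [if_neg hik, quadraticChar_mul_self fun h =>
              hik (e.injective (hr.detForm_eq_zero_iff.1 h))]
        rw [Finset.sum_congr rfl fun k _ => this k]
        simp [Finset.sum_ite, Finset.filter_ne]
      · rw [if_neg hij, ← sum_quadraticChar_detForm hq hr
          (x := r (e i)) (y := r (e j)) fun h => hij (e.injective (hr.detForm_eq_zero_iff.1 h))]
        exact Equiv.sum_comp e (fun P => quadraticChar (ZMod q) (detForm (r (e i)) (r P)) *
          quadraticChar (ZMod q) (detForm (r (e j)) (r P)))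
    rw [Matrix.mul_apply]
    simp only [Matrix.transpose_apply, paleyHadamard_eq e hr, add_mul, mul_add,
      Finset.sum_add_distrib, hS, Matrix.one_apply, ite_mul, mul_ite, one_mul, mul_one, zero_mul,
      mul_zero, Finset.sum_ite_eq, Finset.mem_univ, if_true, Matrix.smul_apply, smul_eq_mul]
    rw [detForm_swap, quadraticChar_neg hq]
    rcases eq_or_ne i j with rfl | hij
    · simp [detForm_self]; ring
    · simp [hij]

end Character

/-! ### Gram matrices and tight frames -/

section Gram

open scoped ComplexOrder

variable {N n : ℕ}

theorem skewGram_apply (H : Matrix (Fin N) (Fin N) ℤ) (i j : Fin N) :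
    skewGram H i j = (1 : Matrix (Fin N) (Fin N) ℂ) i j +
      Complex.I / (Real.sqrt ((N : ℝ) - 1) : ℂ) *
        ((H i j : ℂ) - (1 : Matrix (Fin N) (Fin N) ℂ) i j) := by
  simp [skewGram]

theorem IsSkewHadamard.apply_self {H : Matrix (Fin N) (Fin N) ℤ} (hH : IsSkewHadamard H)
    (i : Fin N) : H i i = 1 := by
  have h := congrFun (congrFun hH.skew i) i
  simp at h
  omega

theorem IsSkewHadamard.skewGram_self {H : Matrix (Fin N) (Fin N) ℤ} (hH : IsSkewHadamard H)
    (i : Fin N) : skewGram H i i = 1 := by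
  simp [skewGram_apply, hH.apply_self]

theorem IsSkewHadamard.isHermitian_skewGram {H : Matrix (Fin N) (Fin N) ℤ}
    (hH : IsSkewHadamard H) : (skewGram H).IsHermitian := by
  ext i j
  rw [Matrix.conjTranspose_apply]
  rcases eq_or_ne i j with rfl | hij
  · simp [hH.skewGram_self]
  · have h := congrFun (congrFun hH.skew i) j
    simp [hij] at h
    have h' : H j i = - H i j := by omega
    simp [skewGram_apply, hij, hij.symm, h', neg_div]

/-- If `H` is skew Hadamard then `S = H - 1` satisfies `S² = -(N - 1)`, so that
`(i / √(N - 1)) S` is an involution and `skewGram H` is twice an idempotent. -/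
theorem IsSkewHadamard.skewGram_mul_self {H : Matrix (Fin N) (Fin N) ℤ}
    (hH : IsSkewHadamard H) (hN : 2 ≤ N) : skewGram H * skewGram H = (2 : ℂ) • skewGram H := by
  set S : Matrix (Fin N) (Fin N) ℂ := H.map (fun z : ℤ => (z : ℂ)) - 1 with hS
  set c : ℂ := Complex.I / (Real.sqrt ((N : ℝ) - 1) : ℂ) with hc
  have hpos : (0 : ℝ) < (N : ℝ) - 1 := by
    have : (2 : ℝ) ≤ N := by exact_mod_cast hN
    linarith
  have hcc : c * c * ((N : ℂ) - 1) = -1 := by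
    have hs : ((Real.sqrt ((N : ℝ) - 1) : ℝ) : ℂ) * (Real.sqrt ((N : ℝ) - 1) : ℝ)
        = (N : ℂ) - 1 := by
      rw [← Complex.ofReal_mul, Real.mul_self_sqrt hpos.le]; simp
    have hne : ((Real.sqrt ((N : ℝ) - 1) : ℝ) : ℂ) ≠ 0 := by
      exact_mod_cast (Real.sqrt_pos.2 hpos).ne'
    rw [hc, ← hs]
    field_simp
    exact Complex.I_sq
  have hHZ : (H - 1) * (H - 1) = (1 - (N : ℤ)) • (1 : Matrix (Fin N) (Fin N) ℤ) := by
    have h1 : H.transpose = (2 : ℤ) • (1 : Matrix (Fin N) (Fin N) ℤ) - H := by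
      rw [← hH.skew]; abel
    have h2 := hH.hadamard
    rw [h1, mul_sub, mul_smul_comm, mul_one] at h2
    rw [sub_mul, mul_sub, sub_smul, ← h2]
    simp only [mul_one, one_mul, two_smul, one_smul]
    abel
  have hSS : S * S = (1 - (N : ℂ)) • (1 : Matrix (Fin N) (Fin N) ℂ) := by
    have h := congrArg (fun M : Matrix (Fin N) (Fin N) ℤ => M.map (Int.castRingHom ℂ)) hHZ
    simp only [Matrix.map_mul] at h
    have hS' : (H - 1).map (Int.castRingHom ℂ) = S := by
      ext i j
      rcases eq_or_ne i j with rfl | hij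
      · simp [hS]
      · simp [hS, hij]
    rw [hS'] at h
    rw [h]
    ext i j
    rcases eq_or_ne i j with rfl | hij
    · simp only [Matrix.map_apply, Matrix.smul_apply, Matrix.one_apply_eq, smul_eq_mul]
      simp
    · simp only [Matrix.map_apply, Matrix.smul_apply, Matrix.one_apply_ne hij, smul_eq_mul]
      simp
  have hg : skewGram H = 1 + c • S := rfl
  have hK : (c • S) * (c • S) = 1 := by
    rw [smul_mul_smul_comm, hSS, smul_smul]
    rw [show c * c * (1 - (N : ℂ)) = 1 by linear_combination -hcc, one_smul]
  rw [hg, add_mul, mul_add, mul_add, hK, two_smul]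
  simp only [mul_one, one_mul]
  abel

theorem IsSkewHadamard.norm_skewGram_apply {H : Matrix (Fin N) (Fin N) ℤ}
    (hH : IsSkewHadamard H) {i j : Fin N} (hij : i ≠ j) :
    ‖skewGram H i j‖ = 1 / |Real.sqrt ((N : ℝ) - 1)| := by
  rcases hH.entries i j with h | h <;>
    simp [skewGram_apply, hij, h]

/-- The frame operator `T` of `2n` unit vectors in `ℂⁿ` whose Gram matrix `G` satisfies `G² = 2G`
has `tr T = tr T²/2 = 2n`, so that `tr (T - 2)² = 0` and `T = 2`. -/
theorem sum_inner_smul_eq {φ : Fin N → E n} (hN : N = 2 * n)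
    (hG : Matrix.gram ℂ φ * Matrix.gram ℂ φ = (2 : ℂ) • Matrix.gram ℂ φ)
    (hunit : ∀ i, Matrix.gram ℂ φ i i = 1) (x : E n) :
    ∑ j, inner ℂ (φ j) x • φ j = (2 : ℂ) • x := by
  set V : Matrix (Fin n) (Fin N) ℂ := Matrix.of fun a j => φ j a with hV
  have hgram : Matrix.gram ℂ φ = V.conjTranspose * V := by
    ext i j
    simp [Matrix.gram, Matrix.mul_apply, hV, PiLp.inner_apply, mul_comm]
  have htr : (V.conjTranspose * V).trace = 2 * n := by
    rw [← hgram, Matrix.trace]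
    simp only [Matrix.diag_apply, hunit]
    simp [hN]
  have hT : V * V.conjTranspose - (2 : ℂ) • 1 = 0 := by
    rw [← Matrix.trace_mul_conjTranspose_self_eq_zero_iff]
    have h1 : (V * V.conjTranspose - (2 : ℂ) • 1).conjTranspose =
        V * V.conjTranspose - (2 : ℂ) • 1 := by
      simp
    have h2 : (V * V.conjTranspose * (V * V.conjTranspose)).trace = 4 * n := by
      rw [Matrix.mul_assoc, Matrix.trace_mul_comm, Matrix.mul_assoc, Matrix.mul_assoc,
        ← Matrix.mul_assoc V.conjTranspose, ← hgram, hG, hgram, Matrix.trace_smul, htr]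
      simp; ring
    rw [h1, sub_mul, mul_sub, mul_sub]
    simp only [Matrix.trace_sub, h2, mul_smul_comm, smul_mul_assoc, mul_one, one_mul,
      Matrix.trace_smul, Matrix.trace_mul_comm V, htr, Matrix.trace_one, Fintype.card_fin,
      smul_eq_mul]
    ring
  have hT' : V * V.conjTranspose = (2 : ℂ) • 1 := sub_eq_zero.1 hT
  ext a
  have h3 : ∀ b, ∑ j, V a j * star (V b j) = 2 * (1 : Matrix (Fin n) (Fin n) ℂ) a b := by
    intro b
    have := congrFun (congrFun hT' a) b
    simpa [Matrix.mul_apply] using this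
  have h4 : (∑ j, inner ℂ (φ j) x • φ j) a = ∑ b, x b * ∑ j, V a j * star (V b j) := by
    simp only [Finset.mul_sum]
    rw [Finset.sum_comm]
    simp [PiLp.inner_apply, Finset.sum_mul, hV]
    refine Finset.sum_congr rfl fun j _ => Finset.sum_congr rfl fun b _ => ?_
    ring
  rw [h4]
  simp only [h3]
  simp [Matrix.one_apply, mul_comm]

theorem span_range_eq_top {φ : Fin N → E n} (h : ∀ x, ∑ j, inner ℂ (φ j) x • φ j = (2 : ℂ) • x) :
    Submodule.span ℂ (Set.range φ) = ⊤ := by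
  rw [eq_top_iff]
  rintro x -
  have hx : x = (2 : ℂ)⁻¹ • ∑ j, inner ℂ (φ j) x • φ j := by
    rw [h x, smul_smul]; simp
  rw [hx]
  exact Submodule.smul_mem _ _ (Submodule.sum_mem _ fun j _ =>
    Submodule.smul_mem _ _ (Submodule.subset_span ⟨j, rfl⟩))

theorem isETF_of_gram_eq {H : Matrix (Fin N) (Fin N) ℤ} (hH : IsSkewHadamard H)
    (hN : N = 2 * n) (hN2 : 2 ≤ N) {φ : Fin N → E n} (hφ : Matrix.gram ℂ φ = skewGram H) :
    IsETF φ := by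
  have hunit : ∀ i, Matrix.gram ℂ φ i i = 1 := fun i => by rw [hφ, hH.skewGram_self]
  have hself : ∀ i, ‖φ i‖ = 1 := fun i => by
    have h := hunit i
    rw [Matrix.gram_apply, inner_self_eq_norm_sq_to_K] at h
    have h' : ‖φ i‖ ^ 2 = 1 := Complex.ofReal_injective (by simpa using h)
    nlinarith [norm_nonneg (φ i)]
  refine ⟨hself, ⟨2, two_pos, fun x => ?_⟩, 1 / |Real.sqrt ((N : ℝ) - 1)|, fun i j hij => ?_⟩
  · have h := congrArg (inner ℂ x) (sum_inner_smul_eq hN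
      (by rw [hφ, hH.skewGram_mul_self hN2]) hunit x)
    rw [inner_sum, inner_smul_right, inner_self_eq_norm_sq_to_K] at h
    have h' : ∀ j, inner ℂ x (inner ℂ (φ j) x • φ j) = ((‖inner ℂ x (φ j)‖ ^ 2 : ℝ) : ℂ) := by
      intro j
      rw [inner_smul_right, ← inner_conj_symm (φ j) x, mul_comm, Complex.mul_conj,
        Complex.normSq_eq_norm_sq]
    simp only [h'] at h
    exact Complex.ofReal_injective (by simpa using h)
  · rw [← hH.norm_skewGram_apply hij, ← hφ, Matrix.gram_apply]

/-- A Hermitian matrix `G` with `G² = 2G` and trace `2n` is a Gram matrix of vectors of `ℂⁿ`: as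
`G/2` is an orthogonal projection of rank `n`, one takes the multiples by `√2` of the projections
of the standard basis. -/
theorem exists_gram_eq {G : Matrix (Fin N) (Fin N) ℂ} (hherm : G.IsHermitian)
    (hG : G * G = (2 : ℂ) • G) (htr : G.trace = 2 * n) :
    ∃ φ : Fin N → E n, Matrix.gram ℂ φ = G := by
  set P : Matrix (Fin N) (Fin N) ℂ := (2 : ℂ)⁻¹ • G with hP
  have hPP : P * P = P := by
    rw [hP, smul_mul_smul_comm, hG, smul_smul]
    norm_num
  have hPh : P.IsHermitian := by
    rw [Matrix.IsHermitian, hP, Matrix.conjTranspose_smul, hherm.eq]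
    simp
  set p : E N →ₗ[ℂ] E N := Matrix.toEuclideanLin P with hp
  have hpp : ∀ x, p (p x) = p x := by
    intro x
    simp [hp, Matrix.toEuclideanLin, Matrix.toLpLin_apply, Matrix.mulVec_mulVec, hPP]
  have hsymm : p.IsSymmetric := Matrix.isSymmetric_toEuclideanLin_iff.2 hPh
  have hproj : LinearMap.IsProj (LinearMap.range p) p :=
    ⟨fun x => ⟨x, rfl⟩, by rintro _ ⟨x, rfl⟩; exact hpp x⟩
  have hrank : Module.finrank ℂ (LinearMap.range p) = n := by
    have h1 := hproj.trace
    have h2 : LinearMap.trace ℂ (E N) p = P.trace := by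
      rw [hp, ← Matrix.trace_toLin_eq P (PiLp.basisFun 2 ℂ (Fin N))]
      rfl
    rw [h2, hP, Matrix.trace_smul, htr] at h1
    simp at h1
    exact_mod_cast h1.symm
  let ι := ((stdOrthonormalBasis ℂ (LinearMap.range p)).reindex (finCongr hrank)).repr
  refine ⟨fun j => ((Real.sqrt 2 : ℝ) : ℂ) •
    ι ⟨p (EuclideanSpace.single j 1), ⟨_, rfl⟩⟩, ?_⟩
  ext i j
  have hs : ((Real.sqrt 2 : ℝ) : ℂ) * ((Real.sqrt 2 : ℝ) : ℂ) = 2 := by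
    rw [← Complex.ofReal_mul, Real.mul_self_sqrt (by norm_num)]; simp
  rw [Matrix.gram_apply, inner_smul_left, inner_smul_right, LinearIsometryEquiv.inner_map_map,
    Submodule.coe_inner, hsymm, hpp, Complex.conj_ofReal, ← mul_assoc, hs]
  simp [hp, Matrix.toEuclideanLin, Matrix.toLpLin_apply, EuclideanSpace.inner_single_left, hP]

/-- Families with the same Gram matrix, the first of which spans, are related by a unitary:
`∑ cᵢ φᵢ ↦ ∑ cᵢ ψᵢ` is well defined because it preserves norms. -/
theorem exists_unitary_of_inner_eq {ι : Type*} {φ ψ : ι → E n}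
    (hspan : Submodule.span ℂ (Set.range φ) = ⊤)
    (hinner : ∀ i j, inner ℂ (ψ i) (ψ j) = inner ℂ (φ i) (φ j)) :
    ∃ Q : U n, ∀ i, Q (φ i) = ψ i := by
  let L := Finsupp.linearCombination ℂ φ
  let L' := Finsupp.linearCombination ℂ ψ
  have hin : ∀ c d, inner ℂ (L' c) (L' d) = inner ℂ (L c) (L d) := by
    intro c d
    simp only [L, L', Finsupp.linearCombination_apply, Finsupp.sum, sum_inner, inner_sum,
      inner_smul_left, inner_smul_right, hinner]
  have hnorm : ∀ c, ‖L' c‖ = ‖L c‖ := by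
    intro c
    rw [@norm_eq_sqrt_re_inner ℂ, @norm_eq_sqrt_re_inner ℂ, hin]
  obtain ⟨s, hs⟩ := L.exists_rightInverse_of_surjective
    (by rw [Finsupp.range_linearCombination, hspan])
  have hLs : ∀ x, L (s x) = x := fun x => LinearMap.congr_fun hs x
  let Q : E n →ₗᵢ[ℂ] E n := ⟨L' ∘ₗ s, fun x => by
    rw [LinearMap.comp_apply, hnorm, hLs]⟩
  refine ⟨Q.toLinearIsometryEquiv rfl, fun i => ?_⟩
  have h : ‖L' (s (φ i) - Finsupp.single i 1)‖ = 0 := by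
    rw [hnorm, map_sub, hLs]
    simp [L]
  rw [norm_eq_zero, map_sub, sub_eq_zero] at h
  simpa [L', Q] using h

end Gram

/-! ### Switching equivalence -/

section Switching

variable {n : ℕ} {ι κ l : Type*}

theorem SwitchingEquiv.trans {φ : ι → E n} {ψ : κ → E n} {θ : l → E n}
    (h : SwitchingEquiv φ ψ) (h' : SwitchingEquiv ψ θ) : SwitchingEquiv φ θ := by
  obtain ⟨σ, c, Q, hc, h⟩ := h
  obtain ⟨τ, d, R, hd, h'⟩ := h'
  refine ⟨σ.trans τ, fun i => d (σ i) * c i, Q.trans R, fun i => by simp [hc, hd], fun i => ?_⟩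
  simp [h', h, mul_smul]

theorem SwitchingEquiv.symm {φ : ι → E n} {ψ : κ → E n}
    (h : SwitchingEquiv φ ψ) : SwitchingEquiv ψ φ := by
  obtain ⟨σ, c, Q, hc, h⟩ := h
  have hne : ∀ i, c i ≠ 0 := fun i h0 => by simpa [h0] using hc i
  refine ⟨σ.symm, fun j => (c (σ.symm j))⁻¹, Q.symm, fun i => by simp [hc], fun j => ?_⟩
  have := h (σ.symm j)
  rw [Equiv.apply_symm_apply] at this
  rw [this, map_smul, Q.symm_apply_apply, smul_smul, inv_mul_cancel₀ (hne _), one_smul]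

theorem SwitchingEquiv.isETF {N : ℕ} {φ ψ : Fin N → E n} (h : SwitchingEquiv φ ψ)
    (hφ : IsETF φ) : IsETF ψ := by
  obtain ⟨σ, c, Q, hc, h⟩ := h.symm
  have key : ∀ i, ‖ψ i‖ = ‖φ (σ i)‖ := fun i => by simp [h, norm_smul, hc]
  refine ⟨fun i => by rw [key, hφ.unit_norm], ?_, ?_⟩
  · obtain ⟨A, hA, htight⟩ := hφ.tight
    refine ⟨A, hA, fun x => ?_⟩
    rw [← Q.norm_map x, ← htight, ← Equiv.sum_comp σ (fun j => ‖inner ℂ (Q x) (φ j)‖ ^ 2)]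
    refine Finset.sum_congr rfl fun j _ => ?_
    rw [h, inner_smul_right, Q.inner_map_map, norm_mul, hc, one_mul]
  · obtain ⟨d, hd⟩ := hφ.equiangular
    refine ⟨d, fun i j hij => ?_⟩
    rw [← hd (σ i) (σ j) (σ.injective.ne hij), h, h, inner_smul_left, inner_smul_right,
      Q.inner_map_map]
    simp [hc]

/-- The triple product `⟨φ_i, φ_j⟩⟨φ_j, φ_k⟩⟨φ_k, φ_i⟩`, in which the phases of the vectors
cancel. -/
noncomputable def tripleProduct (φ : ι → E n) (i j k : ι) : ℂ :=
  inner ℂ (φ i) (φ j) * inner ℂ (φ j) (φ k) * inner ℂ (φ k) (φ i)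

theorem tripleProduct_smul (φ : ι → E n) {c : ι → ℂ} (hc : ∀ i, ‖c i‖ = 1) (Q : U n)
    (i j k : ι) : tripleProduct (fun i => c i • Q (φ i)) i j k = tripleProduct φ i j k := by
  have h : ∀ i, (starRingEnd ℂ) (c i) * c i = 1 := fun i => by
    rw [mul_comm, Complex.mul_conj, Complex.normSq_eq_norm_sq, hc]; simp
  simp only [tripleProduct, inner_smul_left, inner_smul_right, Q.inner_map_map]
  linear_combination (inner ℂ (φ i) (φ j) * inner ℂ (φ j) (φ k) * inner ℂ (φ k) (φ i)) *
    (h i * ((starRingEnd ℂ) (c j) * c j) * ((starRingEnd ℂ) (c k) * c k) +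
      h j * ((starRingEnd ℂ) (c k) * c k) + h k)

theorem SwitchingEquiv.exists_tripleProduct_eq {φ : ι → E n} {ψ : κ → E n}
    (h : SwitchingEquiv φ ψ) :
    ∃ σ : ι ≃ κ, ∀ i j k, tripleProduct ψ (σ i) (σ j) (σ k) = tripleProduct φ i j k := by
  obtain ⟨σ, c, Q, hc, h⟩ := h
  refine ⟨σ, fun i j k => ?_⟩
  rw [← tripleProduct_smul φ hc Q]
  simp only [tripleProduct, h]

end Switching

/-! ### Orbits of strict representations -/

section Strict

variable {n : ℕ}

/-- The triple products of distinct vectors are purely imaginary and do not vanish. -/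
theorem tripleProduct_of_gram_eq {N : ℕ} {H : Matrix (Fin N) (Fin N) ℤ} (hH : IsSkewHadamard H)
    (hN : 2 ≤ N) {φ : Fin N → E n} (hφ : Matrix.gram ℂ φ = skewGram H) {i j k : Fin N}
    (hij : i ≠ j) (hjk : j ≠ k) (hki : k ≠ i) : (tripleProduct φ i j k).im ≠ 0 := by
  have hpos : (0 : ℝ) < (N : ℝ) - 1 := by
    have : (2 : ℝ) ≤ N := by exact_mod_cast hN
    linarith
  have key : ∀ i j : Fin N, i ≠ j → ∃ t : ℝ, t ≠ 0 ∧ inner ℂ (φ i) (φ j) = Complex.I * t := by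
    intro i j hij
    refine ⟨H i j / Real.sqrt ((N : ℝ) - 1), div_ne_zero ?_ (Real.sqrt_pos.2 hpos).ne', ?_⟩
    · rcases hH.entries i j with h | h <;> simp [h]
    · rw [← Matrix.gram_apply, hφ, skewGram_apply]
      simp [hij]
      ring
  obtain ⟨t, ht, h1⟩ := key i j hij
  obtain ⟨u, hu, h2⟩ := key j k hjk
  obtain ⟨v, hv, h3⟩ := key k i hki
  have : tripleProduct φ i j k = ((-(t * u * v) : ℝ) : ℂ) * Complex.I := by
    rw [tripleProduct, h1, h2, h3]
    push_cast
    linear_combination (t * u * v * Complex.I : ℂ) * Complex.I_sq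
  rw [this]
  simp [ht, hu, hv]

/-- The orbit of a vector under a projective representation equivalent to a strict one is, up to
phases and a unitary, the orbit under the strict one. -/
theorem EquivToStrict.exists_switchingEquiv {G : Type*} [Group G] {π : G → U n}
    (h : EquivToStrict π) (v : E n) :
    ∃ (ρ : G →* U n) (w : E n), SwitchingEquiv (fun g => ρ g w) (fun g => π g v) := by
  obtain ⟨ρ, Q, h⟩ := h
  choose α hα h using h
  refine ⟨ρ, Q v, Equiv.refl G, α, Q.symm, hα, fun g => ?_⟩
  have h' := h g (Q v)
  rw [Q.symm_apply_apply] at h'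
  rw [Equiv.refl_apply, ← map_smul, ← h', Q.symm_apply_apply]

theorem inner_orbit {G : Type*} [Group G] (ρ : G →* U n) (v : E n) (g h : G) :
    inner ℂ (ρ g v) (ρ h v) = inner ℂ v (ρ (g⁻¹ * h) v) := by
  conv_lhs => rw [show h = g * (g⁻¹ * h) by group, map_mul]
  exact LinearIsometryEquiv.inner_map_map _ _ _

theorem inner_orbit_im_eq_zero {G : Type*} [Group G] (ρ : G →* U n) (v : E n) {g h : G}
    (hgh : (g⁻¹ * h)⁻¹ = g⁻¹ * h) : (inner ℂ (ρ g v) (ρ h v)).im = 0 := by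
  have h1 : inner ℂ (ρ g v) (ρ h v) = inner ℂ (ρ h v) (ρ g v) := by
    rw [inner_orbit, inner_orbit ρ v h g, ← hgh]; group
  exact Complex.conj_eq_iff_im.1 ((inner_conj_symm _ _).trans h1.symm)

/-- The triple product of the orbit of a strict representation at the vectors indexed by three
elements of a Klein four-group is real, because the matrix coefficient at `v` is real at
involutions. -/
theorem tripleProduct_orbit_im_eq_zero {G : Type*} [Group G] (ρ : G →* U n) (v : E n) {a b : G}
    (ha : a * a = 1) (hb : b * b = 1) (hab : a * b = b * a) :
    (tripleProduct (fun g => ρ g v) 1 a b).im = 0 := by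
  have ha' : a⁻¹ = a := inv_eq_of_mul_eq_one_left ha
  have hb' : b⁻¹ = b := inv_eq_of_mul_eq_one_left hb
  have h1 := inner_orbit_im_eq_zero ρ v (g := 1) (h := a) (by simp [ha'])
  have h2 := inner_orbit_im_eq_zero ρ v (g := a) (h := b) (by simp [ha', hb', hab])
  have h3 := inner_orbit_im_eq_zero ρ v (g := b) (h := 1) (by simp [hb'])
  simp only [tripleProduct, Complex.mul_im, Complex.mul_re, h1, h2, h3]
  simp

theorem not_isStrictDihedral_of_gram_eq {N : ℕ} {H : Matrix (Fin N) (Fin N) ℤ}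
    (hH : IsSkewHadamard H) (hN : 2 ≤ N) (hn : Even n) (hn0 : n ≠ 0) {ψ φ : Fin N → E n}
    (hψ : Matrix.gram ℂ ψ = skewGram H) (hφ : SwitchingEquiv ψ φ) : ¬ IsStrictDihedral φ := by
  rintro ⟨π, v, -, hstrict, -, hsw⟩
  obtain ⟨ρ, w, hρ⟩ := hstrict.exists_switchingEquiv v
  obtain ⟨σ, hσ⟩ := ((hρ.trans hsw).trans hφ.symm).exists_tripleProduct_eq
  obtain ⟨m, rfl⟩ := hn
  have hm : ((m : ZMod (m + m))) ≠ 0 := by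
    rw [Ne, ZMod.natCast_eq_zero_iff]
    exact fun h => by have := Nat.le_of_dvd (by omega) h; omega
  have hmm : (m : ZMod (m + m)) + m = 0 := by
    rw [← Nat.cast_add, ZMod.natCast_self]
  -- with `1` and `ab`, the central rotation `a` and the reflection `b` form a Klein four-group
  set a : DihedralGroup (m + m) := DihedralGroup.r m with ha
  set b : DihedralGroup (m + m) := DihedralGroup.sr 0 with hb
  have h1a : (1 : DihedralGroup (m + m)) ≠ a := by
    rw [DihedralGroup.one_def, ha, Ne, DihedralGroup.r.injEq]
    exact hm.symm
  have hab : a ≠ b := by simp [ha, hb]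
  have hb1 : b ≠ 1 := by rw [DihedralGroup.one_def, hb]; simp [-DihedralGroup.r_zero]
  refine tripleProduct_of_gram_eq hH hN hψ (σ.injective.ne h1a) (σ.injective.ne hab)
    (σ.injective.ne hb1) ?_
  rw [hσ]
  refine tripleProduct_orbit_im_eq_zero ρ w ?_ ?_ ?_
  · rw [ha, DihedralGroup.r_mul_r, hmm, DihedralGroup.r_zero]
  · simp [hb]
  · rw [ha, hb, DihedralGroup.r_mul_sr, DihedralGroup.sr_mul_r, zero_sub, zero_add,
      neg_eq_of_add_eq_zero_left hmm]

end Strict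

/-! ### The field with `q²` elements -/

section QuadraticField

/-- The field `𝔽_q[i]` with `q²` elements (for `q ≡ 3 mod 4`), a model of the plane `𝔽_q²`. -/
abbrev QuadField (q : ℕ) : Type := QuadraticAlgebra (ZMod q) (-1) 0

/-- The identification of `𝔽_q[i]` with the plane, with coordinates real and imaginary part. -/
noncomputable abbrev toPlane (q : ℕ) : QuadField q ≃ₗ[ZMod q] Plane q :=
  QuadraticAlgebra.linearEquivTuple (-1) 0

variable {q : ℕ} [Fact q.Prime]

theorem detForm_toPlane (x y : QuadField q) :
    detForm (toPlane q x) (toPlane q y) = x.re * y.im - x.im * y.re := by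
  simp [detForm]

theorem detForm_toPlane_mul (u x y : QuadField q) :
    detForm (toPlane q (u * x)) (toPlane q (u * y)) =
      QuadraticAlgebra.norm u * detForm (toPlane q x) (toPlane q y) := by
  simp only [detForm_toPlane, QuadraticAlgebra.norm_def, QuadraticAlgebra.re_mul,
    QuadraticAlgebra.im_mul]
  ring

theorem detForm_toPlane_star (x y : QuadField q) :
    detForm (toPlane q (star x)) (toPlane q (star y)) =
      -detForm (toPlane q x) (toPlane q y) := by
  simp only [detForm_toPlane, QuadraticAlgebra.re_star, QuadraticAlgebra.im_star]
  ring

instance : Finite (QuadField q) := Finite.of_equiv _ (toPlane q).symm.toEquiv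

theorem card_quadField : Nat.card (QuadField q) = q ^ 2 := by
  rw [Nat.card_congr (toPlane q).toEquiv]
  simp

variable [hq : Fact (q % 4 = 3)]

instance : Fact (∀ x : ZMod q, x ^ 2 ≠ -1 + 0 * x) :=
  ⟨fun x h => not_isSquare_neg_one hq.out ⟨x, by linear_combination -h⟩⟩

instance : CharP (QuadField q) q :=
  charP_of_injective_algebraMap (algebraMap (ZMod q) (QuadField q)).injective q

/-- Conjugation is the Frobenius map, since `i^q = -i` for `q ≡ 3 mod 4`. -/
theorem star_eq_pow (x : QuadField q) : star x = x ^ q := by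
  have hω : (QuadraticAlgebra.omega : QuadField q) ^ q = -QuadraticAlgebra.omega := by
    have h2 : (QuadraticAlgebra.omega : QuadField q) ^ 2 = -1 := by
      rw [sq]; ext <;> simp [QuadraticAlgebra.re_one, QuadraticAlgebra.im_one]
    have hodd : Odd (q / 2) := Nat.odd_iff.2 (by have := hq.out; omega)
    have hq2 : q = 2 * (q / 2) + 1 := by have := hq.out; omega
    rw [show (QuadraticAlgebra.omega : QuadField q) ^ q = QuadraticAlgebra.omega ^ (2 * (q / 2) + 1)
      from congrArg _ hq2, pow_succ, pow_mul, h2, hodd.neg_one_pow, neg_one_mul]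
  have hx : x = algebraMap _ _ x.re + algebraMap _ _ x.im * QuadraticAlgebra.omega := by
    ext <;> simp
  conv_rhs => rw [hx]
  rw [add_pow_char, mul_pow, hω, ← map_pow, ← map_pow, ZMod.pow_card, ZMod.pow_card]
  ext <;> simp

theorem exists_generator : ∃ ω : (QuadField q)ˣ, orderOf ω = q ^ 2 - 1 := by
  obtain ⟨ω, hω⟩ := IsCyclic.exists_ofOrder_eq_natCard (α := (QuadField q)ˣ)
  exact ⟨ω, by rw [hω, Nat.card_units, card_quadField]⟩

variable {ω : (QuadField q)ˣ}

theorem pow_half_eq_neg_one (hω : orderOf ω = q ^ 2 - 1) :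
    (ω : QuadField q) ^ ((q + 1) / 2 * (q - 1)) = -1 := by
  have h3 := hq.out
  -- the exponent is half the order of `ω`
  obtain ⟨k, hk⟩ : ∃ k, q = 2 * k + 1 := ⟨q / 2, by omega⟩
  have hk0 : 0 < k := by omega
  have he : q ^ 2 - 1 = 2 * ((q + 1) / 2 * (q - 1)) := by
    rw [show (q + 1) / 2 = k + 1 by omega, show q - 1 = 2 * k by omega, hk]
    rw [Nat.sub_eq_iff_eq_add (by nlinarith)]
    ring
  set m := (q + 1) / 2 * (q - 1) with hm
  have hm0 : 0 < m := by
    rw [hm]; exact Nat.mul_pos (by omega) (by omega)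
  have hsq : ((ω : QuadField q) ^ m) ^ 2 = 1 := by
    rw [← pow_mul, mul_comm m, ← he, ← hω]
    rw [← Units.val_pow_eq_pow_val, pow_orderOf_eq_one, Units.val_one]
  refine (mul_self_eq_one_iff.1 ((sq _).symm.trans hsq)).resolve_left ?_
  intro h
  have h1 : ω ^ m = 1 := Units.ext (by simpa using h)
  have := orderOf_le_of_pow_eq_one hm0 h1
  omega

theorem pow_q_add_one (x : QuadField q) :
    x ^ (q + 1) = algebraMap (ZMod q) _ (QuadraticAlgebra.norm x) := by
  rw [QuadraticAlgebra.algebraMap_norm_eq_mul_star, star_eq_pow, pow_succ']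

theorem norm_units_ne_zero (u : (QuadField q)ˣ) : QuadraticAlgebra.norm (u : QuadField q) ≠ 0 :=
  fun h => u.ne_zero (QuadraticAlgebra.norm_eq_zero_iff_eq_zero.1 h)

/-- The norm of a generator generates `𝔽_q^*`, so it is not a square. -/
theorem quadraticChar_norm_generator (hω : orderOf ω = q ^ 2 - 1) :
    quadraticChar (ZMod q) (QuadraticAlgebra.norm (ω : QuadField q)) = -1 := by
  have h3 := hq.out
  rw [quadraticChar_neg_one_iff_not_isSquare]
  rintro ⟨s, hs⟩
  have hs0 : s ≠ 0 := by
    rintro rfl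
    exact norm_units_ne_zero ω (by simpa using hs)
  have h1 := pow_half_eq_neg_one hω
  have he : (q + 1) / 2 * (q - 1) = (q + 1) * ((q - 1) / 2) := by
    obtain ⟨k, hk⟩ : ∃ k, q = 2 * k + 1 := ⟨q / 2, by omega⟩
    rw [show (q + 1) / 2 = k + 1 by omega, show (q - 1) / 2 = k by omega,
      show q - 1 = 2 * k by omega, show q + 1 = 2 * (k + 1) by omega]
    ring
  rw [he, pow_mul, pow_q_add_one, hs, ← sq, ← map_pow, ← pow_mul,
    show 2 * ((q - 1) / 2) = q - 1 by omega, ZMod.pow_card_sub_one_eq_one hs0, map_one] at h1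
  have h2 := congrArg QuadraticAlgebra.re h1
  simp only [QuadraticAlgebra.re_one, QuadraticAlgebra.re_neg] at h2
  have h4 : (2 : ZMod q) = 0 := by linear_combination h2
  have h5 : ((2 : ℕ) : ZMod q) = 0 := by exact_mod_cast h4
  rw [ZMod.natCast_eq_zero_iff] at h5
  exact absurd (Nat.le_of_dvd two_pos h5) (by omega)

/-- Powers of a generator represent the same point of the projective line exactly when their
exponents agree modulo `q + 1`. -/
theorem zpow_eq_smul_zpow_iff (hω : orderOf ω = q ^ 2 - 1) (a b : ℤ) :
    (∃ c : ZMod q, ((ω ^ a : (QuadField q)ˣ) : QuadField q) = c • ((ω ^ b : (QuadField q)ˣ) :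
      QuadField q)) ↔ ((q : ℤ) + 1) ∣ a - b := by
  have h3 := hq.out
  constructor
  · rintro ⟨c, hc⟩
    have hc0 : c ≠ 0 := by
      rintro rfl
      exact (ω ^ a).ne_zero (by rw [hc, zero_smul])
    have h1 : ω ^ ((a - b) * ((q - 1 : ℕ) : ℤ)) = 1 := by
      rw [zpow_mul, zpow_natCast, zpow_sub]
      ext1
      rw [Units.val_pow_eq_pow_val, Units.val_mul, hc, smul_mul_assoc, Units.mul_inv, smul_pow,
        ZMod.pow_card_sub_one_eq_one hc0]
      simp
    have h2 := orderOf_dvd_iff_zpow_eq_one.2 h1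
    have he : ((q ^ 2 - 1 : ℕ) : ℤ) = ((q : ℤ) + 1) * ((q - 1 : ℕ) : ℤ) := by
      rw [Nat.cast_sub (Nat.one_le_pow _ _ (by omega)), Nat.cast_sub (by omega)]
      push_cast; ring
    rw [hω, he] at h2
    exact Int.dvd_of_mul_dvd_mul_right (by omega) h2
  · rintro ⟨k, hk⟩
    set N := Units.mk0 _ (norm_units_ne_zero ω) with hN
    have h1 : ω ^ (q + 1) = Units.map (algebraMap (ZMod q) (QuadField q)).toMonoidHom N := by
      ext1
      simpa [hN] using pow_q_add_one (ω : QuadField q)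
    refine ⟨((N ^ k : (ZMod q)ˣ) : ZMod q), ?_⟩
    have h2 : ω ^ a = Units.map (algebraMap (ZMod q) (QuadField q)).toMonoidHom (N ^ k) *
        ω ^ b := by
      rw [map_zpow, ← h1, ← zpow_natCast, ← zpow_mul, ← zpow_add]
      congr 1
      push_cast
      linarith
    rw [h2, Units.val_mul, Units.coe_map, Algebra.smul_def]
    rfl

end QuadraticField

/-! ### The dihedral action on the plane -/

section Action

variable {q : ℕ} [Fact q.Prime] {n : ℕ}

/-- The semisimilitudes of `𝔽_q[i]` that lift the regular action of the dihedral group on the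
projective line: the rotation `r i` is the multiplication by `ω^(2i)`, and the reflection `sr i` is
the conjugation followed by the multiplication by `ω^(1-2i)`. The representative of `i` in
`[0, n)` is an arbitrary choice, which changes the map by a scalar. -/
def dihedralMap (ω : (QuadField q)ˣ) : DihedralGroup n → QuadField q → QuadField q
  | .r i, x => (ω ^ (2 * (i.val : ℤ)) : (QuadField q)ˣ) * x
  | .sr i, x => (ω ^ (1 - 2 * (i.val : ℤ)) : (QuadField q)ˣ) * star x

theorem dihedralMap_smul (ω : (QuadField q)ˣ) (g : DihedralGroup n) (c : ZMod q)
    (x : QuadField q) : dihedralMap ω g (c • x) = c • dihedralMap ω g x := by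
  cases g with
  | r i => simp [dihedralMap]
  | sr i =>
    have : star (c • x) = c • star x := by ext <;> simp
    simp [dihedralMap, this]

theorem dihedralMap_ne_zero [Fact (q % 4 = 3)] (ω : (QuadField q)ˣ) (g : DihedralGroup n)
    {x : QuadField q} (hx : x ≠ 0) : dihedralMap ω g x ≠ 0 := by
  cases g with
  | r i => exact mul_ne_zero (Units.ne_zero _) hx
  | sr i => exact mul_ne_zero (Units.ne_zero _) (star_ne_zero.2 hx)

variable [hq : Fact (q % 4 = 3)] {ω : (QuadField q)ˣ}

/-- The maps `dihedralMap ω g` have determinants in the nonzero squares: conjugation has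
determinant `-1`, not a square, and so has the multiplication by an odd power of `ω`. -/
theorem quadraticChar_detForm_dihedralMap (hω : orderOf ω = q ^ 2 - 1) (g : DihedralGroup n)
    (x y : QuadField q) :
    quadraticChar (ZMod q)
        (detForm (toPlane q (dihedralMap ω g x)) (toPlane q (dihedralMap ω g y))) =
      quadraticChar (ZMod q) (detForm (toPlane q x) (toPlane q y)) := by
  let χ : (QuadField q)ˣ →* ℤˣ := Units.map
    ((quadraticChar (ZMod q)).toMonoidHom.comp QuadraticAlgebra.norm)
  have hχ : ∀ u : (QuadField q)ˣ,
      quadraticChar (ZMod q) (QuadraticAlgebra.norm (u : QuadField q)) = χ u :=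
    fun _ => rfl
  have h1 : χ ω = -1 := Units.ext (by rw [← hχ, quadraticChar_norm_generator hω]; rfl)
  have h2 : ∀ k : ℤ, χ (ω ^ (2 * k)) = 1 := fun k => by
    rw [map_zpow, h1, zpow_mul]; simp
  cases g with
  | r i =>
    simp only [dihedralMap]
    rw [detForm_toPlane_mul, map_mul, hχ, h2]
    simp
  | sr i =>
    simp only [dihedralMap]
    rw [detForm_toPlane_mul, map_mul, hχ, zpow_sub, map_mul, map_inv, h2, zpow_one, h1,
      detForm_toPlane_star, quadraticChar_neg hq.out]
    simp

theorem dvd_val_add [NeZero n] (i j : ZMod n) :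
    (n : ℤ) ∣ ((i + j).val : ℤ) - (i.val + j.val) := by
  rw [← ZMod.intCast_eq_intCast_iff_dvd_sub]
  simp

theorem dvd_val_sub [NeZero n] (i j : ZMod n) :
    (n : ℤ) ∣ ((i - j).val : ℤ) - (i.val - j.val) := by
  rw [← ZMod.intCast_eq_intCast_iff_dvd_sub]
  simp

theorem star_units_zpow (ω : (QuadField q)ˣ) (k : ℤ) :
    star ((ω ^ k : (QuadField q)ˣ) : QuadField q) = (ω ^ (q * k) : (QuadField q)ˣ) := by
  rw [star_eq_pow, ← Units.val_pow_eq_pow_val, ← zpow_natCast, ← zpow_mul, mul_comm]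

/-- Modulo scalars, `dihedralMap ω` is a homomorphism: in each case both sides are multiples of `x`
or of `star x` by powers of `ω`, whose exponents agree modulo `q + 1 = 2n`. -/
theorem dihedralMap_mul [NeZero n] (hω : orderOf ω = q ^ 2 - 1) (hn : q + 1 = 2 * n)
    (g h : DihedralGroup n) : ∃ c : ZMod q, ∀ x,
      dihedralMap ω (g * h) x = c • dihedralMap ω g (dihedralMap ω h x) := by
  have hn' : (q : ℤ) + 1 = 2 * n := by exact_mod_cast hn
  cases g with
  | r i =>
    cases h with
    | r j =>
      obtain ⟨k, hk⟩ := dvd_val_add i j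
      obtain ⟨c, hc⟩ := (zpow_eq_smul_zpow_iff hω (2 * ((i + j).val : ℤ))
        (2 * i.val + 2 * j.val)).2 ⟨k, by rw [hn']; linear_combination 2 * hk⟩
      refine ⟨c, fun x => ?_⟩
      rw [DihedralGroup.r_mul_r]
      simp only [dihedralMap]
      rw [hc, zpow_add, Units.val_mul, smul_mul_assoc, mul_assoc]
    | sr j =>
      obtain ⟨k, hk⟩ := dvd_val_sub j i
      obtain ⟨c, hc⟩ := (zpow_eq_smul_zpow_iff hω (1 - 2 * ((j - i).val : ℤ))
        (2 * i.val + (1 - 2 * j.val))).2 ⟨-k, by rw [hn']; linear_combination (-2) * hk⟩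
      refine ⟨c, fun x => ?_⟩
      rw [DihedralGroup.r_mul_sr]
      simp only [dihedralMap]
      rw [hc, zpow_add, Units.val_mul, smul_mul_assoc, mul_assoc]
  | sr i =>
    cases h with
    | r j =>
      obtain ⟨k, hk⟩ := dvd_val_add i j
      obtain ⟨c, hc⟩ := (zpow_eq_smul_zpow_iff hω (1 - 2 * ((i + j).val : ℤ))
        (1 - 2 * i.val + q * (2 * j.val))).2
        ⟨-k - 2 * j.val, by linear_combination (-2) * hk + k * hn'⟩
      refine ⟨c, fun x => ?_⟩
      rw [DihedralGroup.sr_mul_r]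
      simp only [dihedralMap, star_mul', star_units_zpow]
      rw [hc, zpow_add, Units.val_mul, smul_mul_assoc, mul_assoc]
    | sr j =>
      obtain ⟨k, hk⟩ := dvd_val_sub j i
      obtain ⟨c, hc⟩ := (zpow_eq_smul_zpow_iff hω (2 * ((j - i).val : ℤ))
        (1 - 2 * i.val + q * (1 - 2 * j.val))).2
        ⟨k + 2 * j.val - 1, by linear_combination 2 * hk - k * hn'⟩
      refine ⟨c, fun x => ?_⟩
      rw [DihedralGroup.sr_mul_sr]
      simp only [dihedralMap, star_mul', star_units_zpow, star_star]
      rw [hc, zpow_add, Units.val_mul, smul_mul_assoc, mul_assoc]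

/-- The dihedral group acts freely on the projective line. -/
theorem dihedralMap_one_injective [NeZero n] (hω : orderOf ω = q ^ 2 - 1) (hn : q + 1 = 2 * n)
    {g h : DihedralGroup n} {c : ZMod q} (hc : dihedralMap ω g 1 = c • dihedralMap ω h 1) :
    g = h := by
  have hn' : (q : ℤ) + 1 = 2 * n := by exact_mod_cast hn
  have hval : ∀ i j : ZMod n, ((q : ℤ) + 1) ∣ 2 * i.val - 2 * j.val → i = j := by
    intro i j hij
    rw [hn', ← mul_sub] at hij
    have := (ZMod.intCast_eq_intCast_iff_dvd_sub _ _ _).2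
      (Int.dvd_of_mul_dvd_mul_left two_ne_zero hij)
    simpa using this.symm
  have hparity : ∀ i j : ZMod n, ¬ ((q : ℤ) + 1) ∣ 2 * i.val - (1 - 2 * j.val) := by
    rintro i j ⟨k, hk⟩
    rw [hn', mul_assoc] at hk
    omega
  have hparity' : ∀ i j : ZMod n, ¬ ((q : ℤ) + 1) ∣ (1 - 2 * i.val) - 2 * j.val := by
    rintro i j ⟨k, hk⟩
    rw [hn', mul_assoc] at hk
    omega
  cases g with
  | r i =>
    cases h with
    | r j =>
      simp only [dihedralMap, mul_one] at hc
      rw [hval i j ((zpow_eq_smul_zpow_iff hω _ _).1 ⟨c, hc⟩)]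
    | sr j =>
      simp only [dihedralMap, star_one, mul_one] at hc
      exact absurd ((zpow_eq_smul_zpow_iff hω _ _).1 ⟨c, hc⟩) (hparity i j)
  | sr i =>
    cases h with
    | r j =>
      simp only [dihedralMap, star_one, mul_one] at hc
      exact absurd ((zpow_eq_smul_zpow_iff hω _ _).1 ⟨c, hc⟩) (hparity' i j)
    | sr j =>
      simp only [dihedralMap, star_one, mul_one] at hc
      have := (zpow_eq_smul_zpow_iff hω _ _).1 ⟨c, hc⟩
      rw [hval j i (by convert this using 1; ring)]

/-- The central rotation `x ↦ ω^n x` of the dihedral group and a reflection commute only up to the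
scalar `-1`, because conjugation is the `q`-th power map and `ω^(n(q-1)) = -1`. -/
theorem dihedralMap_anticommute {m : ℕ} (hω : orderOf ω = q ^ 2 - 1) (hm : q + 1 = 2 * (m + m))
    (x : QuadField q) :
    dihedralMap ω (DihedralGroup.r (m : ZMod (m + m)))
        (dihedralMap ω (DihedralGroup.sr (0 : ZMod (m + m))) x) =
      (-1 : ZMod q) • dihedralMap ω (DihedralGroup.sr (0 : ZMod (m + m)))
        (dihedralMap ω (DihedralGroup.r (m : ZMod (m + m))) x) := by
  have hval : ((m : ZMod (m + m))).val = m := ZMod.val_natCast_of_lt (by omega)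
  have hstar : star ((ω ^ (2 * (m : ℤ)) : (QuadField q)ˣ) : QuadField q) =
      -((ω ^ (2 * (m : ℤ)) : (QuadField q)ˣ) : QuadField q) := by
    have h1 := pow_half_eq_neg_one hω
    have h2 : ω ^ (2 * (m : ℤ)) = ω ^ (m + m) := by
      rw [← zpow_natCast]; congr 1; push_cast; ring
    rw [h2, star_eq_pow, Units.val_pow_eq_pow_val, ← pow_mul]
    rw [show (q + 1) / 2 = m + m by omega] at h1
    have h3 : (m + m) * q = (m + m) * (q - 1) + (m + m) := by
      obtain ⟨k, rfl⟩ : ∃ k, q = k + 1 := ⟨q - 1, by have := hq.out; omega⟩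
      simp [mul_add]
    rw [h3, pow_add, h1, neg_one_mul]
  simp only [dihedralMap, hval, star_mul', hstar, ZMod.val_zero]
  rw [neg_smul, one_smul]
  ring

end Action

/-! ### The Paley frame as a genuinely projective orbit -/

section ProjectiveRepresentation

variable {n : ℕ}

/-- Commuting group elements act by commuting operators in a projective representation that is
equivalent to a strict one: the phases cancel in the commutator. -/
theorem EquivToStrict.apply_comm {G : Type*} [Group G] {π : G → U n} (h : EquivToStrict π)
    {a b : G} (hab : a * b = b * a) (x : E n) : π a (π b x) = π b (π a x) := by
  obtain ⟨ρ, Q, h⟩ := h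
  choose α hα h using h
  have h' : ∀ g y, Q (π g y) = α g • ρ g (Q y) := fun g y => by
    rw [← h g (Q y), Q.symm_apply_apply]
  apply Q.injective
  have hρ : ρ a (ρ b (Q x)) = ρ b (ρ a (Q x)) := by
    change (ρ a * ρ b) (Q x) = (ρ b * ρ a) (Q x)
    rw [← map_mul, hab, map_mul]
  rw [h', h', h', h', map_smul, map_smul, hρ, smul_comm]

end ProjectiveRepresentation

section PaleyFrame

variable {q : ℕ} [Fact q.Prime] {n : ℕ}

theorem IsLift.exists_eq_smul (e : Fin (q + 1) ≃ ProjLine q) {r : ProjLine q → Plane q}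
    (hr : IsLift r) (x : QuadField q) (hx : x ≠ 0) :
    ∃ (i : Fin (q + 1)) (c : ZMod q), c ≠ 0 ∧ x = c • (toPlane q).symm (r (e i)) := by
  obtain ⟨P, u, h⟩ := hr.exists_smul ((toPlane q).map_ne_zero_iff.2 hx)
  refine ⟨e.symm P, u, u.ne_zero, (toPlane q).injective ?_⟩
  rw [h, Units.smul_def, map_smul, LinearEquiv.apply_symm_apply, Equiv.apply_symm_apply]

/-- An extension of the vectors of a frame, indexed by the points of the projective line, to
vectors indexed by the whole plane `𝔽_q[i]`, on which scalars act by the quadratic character. -/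
theorem exists_homogeneous_extension (e : Fin (q + 1) ≃ ProjLine q) {r : ProjLine q → Plane q}
    (hr : IsLift r) (ψ : Fin (q + 1) → E n) :
    ∃ Ψ : QuadField q → E n,
      (∀ i (c : ZMod q), Ψ (c • (toPlane q).symm (r (e i))) =
        ((quadraticChar (ZMod q) c : ℤ) : ℂ) • ψ i) ∧
      ∀ (c : ZMod q) x, Ψ (c • x) = ((quadraticChar (ZMod q) c : ℤ) : ℂ) • Ψ x := by
  classical
  choose! I u hu hIu using hr.exists_eq_smul e
  -- at `0` the value has to be `0`, as it is for the quadratic character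
  let Ψ : QuadField q → E n := fun x =>
    if x = 0 then 0 else ((quadraticChar (ZMod q) (u x) : ℤ) : ℂ) • ψ (I x)
  have hΨ : ∀ i (c : ZMod q), Ψ (c • (toPlane q).symm (r (e i))) =
      ((quadraticChar (ZMod q) c : ℤ) : ℂ) • ψ i := by
    intro i c
    by_cases hc : c = 0
    · simp [Ψ, hc]
    · have hb : (toPlane q).symm (r (e i)) ≠ 0 :=
        (toPlane q).symm.map_ne_zero_iff.2 (hr.ne_zero (e i))
      have hne := smul_ne_zero hc hb
      have h := congrArg (toPlane q) (hIu _ hne)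
      rw [map_smul, map_smul, LinearEquiv.apply_symm_apply, LinearEquiv.apply_symm_apply] at h
      obtain ⟨h1, h2⟩ := hr.smul_injective (u := Units.mk0 c hc) (v := Units.mk0 _ (hu _ hne)) h
      have h3 : u (c • (toPlane q).symm (r (e i))) = c := (congrArg Units.val h2).symm
      simp only [Ψ, if_neg hne]
      rw [← e.injective h1, h3]
  refine ⟨Ψ, hΨ, fun c x => ?_⟩
  by_cases hx : x = 0
  · simp [hx, Ψ]
  · rw [hIu x hx, smul_smul, hΨ, hΨ, map_mul, smul_smul]
    push_cast
    rfl

/-- The system `Ψ` of vectors of the Paley frame, indexed by the elements of `𝔽_q[i]`: scalars act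
on it by the quadratic character, and the inner products depend on the determinants only. -/
structure IsPaleySystem (Ψ : QuadField q → E n) : Prop where
  map_smul : ∀ (c : ZMod q) x, Ψ (c • x) = ((quadraticChar (ZMod q) c : ℤ) : ℂ) • Ψ x
  norm_eq_one : ∀ x, x ≠ 0 → ‖Ψ x‖ = 1
  inner_eq : ∀ x y, detForm (toPlane q x) (toPlane q y) ≠ 0 →
    inner ℂ (Ψ x) (Ψ y) = Complex.I / (Real.sqrt q : ℂ) *
      (quadraticChar (ZMod q) (detForm (toPlane q x) (toPlane q y)) : ℤ)
  span_eq_top : Submodule.span ℂ (Set.range Ψ) = ⊤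

theorem IsPaleySystem.inner_comp {Ψ : QuadField q → E n} (h : IsPaleySystem Ψ)
    {T : QuadField q → QuadField q} (hsmul : ∀ (c : ZMod q) x, T (c • x) = c • T x)
    (hne : ∀ x, x ≠ 0 → T x ≠ 0)
    (hdet : ∀ x y, quadraticChar (ZMod q) (detForm (toPlane q (T x)) (toPlane q (T y))) =
      quadraticChar (ZMod q) (detForm (toPlane q x) (toPlane q y))) (x y : QuadField q) :
    inner ℂ (Ψ (T x)) (Ψ (T y)) = inner ℂ (Ψ x) (Ψ y) := by
  have hzero : Ψ 0 = 0 := by simpa using h.map_smul 0 0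
  have hT0 : T 0 = 0 := by simpa using hsmul 0 0
  -- on linearly dependent vectors the inner product comes from homogeneity and the norms
  by_cases hxy : detForm (toPlane q x) (toPlane q y) = 0
  · by_cases hx : x = 0
    · simp [hx, hT0, hzero]
    · obtain ⟨c, hc⟩ := exists_smul_of_detForm_eq_zero ((toPlane q).map_ne_zero_iff.2 hx) hxy
      have hy : y = c • x := (toPlane q).injective (by rw [hc, _root_.map_smul])
      rw [hy, hsmul, h.map_smul, h.map_smul, inner_smul_right, inner_smul_right,
        inner_self_eq_norm_sq_to_K, inner_self_eq_norm_sq_to_K, h.norm_eq_one _ hx,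
        h.norm_eq_one _ (hne x hx)]
  · have hT : detForm (toPlane q (T x)) (toPlane q (T y)) ≠ 0 := fun h0 => by
      have := hdet x y
      rw [h0, quadraticChar_zero, eq_comm, quadraticChar_eq_zero_iff] at this
      exact hxy this
    rw [h.inner_eq x y hxy, h.inner_eq _ _ hT, hdet]

variable [hq : Fact (q % 4 = 3)]

/-- The dihedral group acts on a Paley system through a projective representation. -/
theorem IsPaleySystem.exists_projRep [NeZero n] {Ψ : QuadField q → E n} (h : IsPaleySystem Ψ)
    {ω : (QuadField q)ˣ} (hω : orderOf ω = q ^ 2 - 1) (hn : q + 1 = 2 * n) :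
    ∃ π : DihedralGroup n → U n, IsProjRep π ∧ ∀ g x, π g (Ψ x) = Ψ (dihedralMap ω g x) := by
  have hex : ∀ g : DihedralGroup n, ∃ Q : U n, ∀ x, Q (Ψ x) = Ψ (dihedralMap ω g x) := fun g =>
    exists_unitary_of_inner_eq (ψ := fun x => Ψ (dihedralMap ω g x)) h.span_eq_top
      (h.inner_comp (dihedralMap_smul ω g) (fun _ hx => dihedralMap_ne_zero ω g hx)
        (quadraticChar_detForm_dihedralMap hω g))
  choose π hπ using hex
  refine ⟨π, fun g g' => ?_, hπ⟩
  obtain ⟨c, hc⟩ := dihedralMap_mul hω hn g g'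
  have hc0 : c ≠ 0 := by
    rintro rfl
    exact dihedralMap_ne_zero ω (g * g') one_ne_zero (by rw [hc 1, zero_smul])
  refine ⟨((quadraticChar (ZMod q) c : ℤ) : ℂ), ?_, fun x => ?_⟩
  · rcases quadraticChar_dichotomy hc0 with h1 | h1 <;> simp [h1]
  · have hlin : ((π (g * g')).toLinearEquiv : E n →ₗ[ℂ] E n) =
        ((quadraticChar (ZMod q) c : ℤ) : ℂ) •
          (((π g).toLinearEquiv : E n →ₗ[ℂ] E n) ∘ₗ ((π g').toLinearEquiv : E n →ₗ[ℂ] E n)) := by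
      refine LinearMap.ext_on_range h.span_eq_top fun x => ?_
      simp [hπ, hc, h.map_smul]
    exact LinearMap.congr_fun hlin x

theorem isPaleySystem_of_gram_eq (hn : q + 1 = 2 * n) {e : Fin (q + 1) ≃ ProjLine q}
    {r : ProjLine q → Plane q} (hr : IsLift r) {ψ : Fin (q + 1) → E n}
    (hψ : Matrix.gram ℂ ψ = skewGram (paleyHadamard e r)) {Ψ : QuadField q → E n}
    (hΨ : ∀ i (c : ZMod q), Ψ (c • (toPlane q).symm (r (e i))) =
        ((quadraticChar (ZMod q) c : ℤ) : ℂ) • ψ i)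
    (hsmul : ∀ (c : ZMod q) x, Ψ (c • x) = ((quadraticChar (ZMod q) c : ℤ) : ℂ) • Ψ x) :
    IsPaleySystem Ψ := by
  have hH := isSkewHadamard_paleyHadamard hq.out e hr
  have h2 : 2 ≤ q + 1 := by have := hq.out; omega
  have hetf := isETF_of_gram_eq hH hn h2 hψ
  refine ⟨hsmul, fun x hx => ?_, fun x y hxy => ?_, ?_⟩
  · obtain ⟨i, c, hc, rfl⟩ := hr.exists_eq_smul e x hx
    rw [hΨ, norm_smul, hetf.unit_norm]
    rcases quadraticChar_dichotomy hc with h1 | h1 <;> simp [h1]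
  · have hx : x ≠ 0 := by rintro rfl; simp [detForm] at hxy
    have hy : y ≠ 0 := by rintro rfl; simp [detForm] at hxy
    obtain ⟨i, c, hc, rfl⟩ := hr.exists_eq_smul e x hx
    obtain ⟨j, d, hd, rfl⟩ := hr.exists_eq_smul e y hy
    simp only [_root_.map_smul, LinearEquiv.apply_symm_apply, detForm_smul_left,
      detForm_smul_right] at hxy ⊢
    have hij : i ≠ j := by rintro rfl; simp [detForm_self] at hxy
    rw [hΨ, hΨ, inner_smul_left, inner_smul_right, ← Matrix.gram_apply, hψ, skewGram_apply,
      paleyHadamard_apply_of_ne hr hij, map_mul, map_mul]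
    simp only [Matrix.one_apply_ne hij, map_intCast]
    push_cast
    simp only [add_sub_cancel_right]
    ring
  · rw [eq_top_iff, ← span_range_eq_top (sum_inner_smul_eq hn
      (by rw [hψ, hH.skewGram_mul_self h2]) fun i => by rw [hψ, hH.skewGram_self])]
    refine Submodule.span_mono ?_
    rintro _ ⟨i, rfl⟩
    exact ⟨(1 : ZMod q) • (toPlane q).symm (r (e i)), by rw [hΨ]; simp⟩

theorem isGenuineProjectiveDihedral_of_gram_eq [NeZero n] (hn : q + 1 = 2 * n)
    {e : Fin (q + 1) ≃ ProjLine q} {r : ProjLine q → Plane q} (hr : IsLift r)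
    {ψ φ : Fin (q + 1) → E n} (hψ : Matrix.gram ℂ ψ = skewGram (paleyHadamard e r))
    (hφ : SwitchingEquiv ψ φ) : IsGenuineProjectiveDihedral φ := by
  obtain ⟨Ψ, hΨ, hsmul⟩ := exists_homogeneous_extension e hr ψ
  have hP := isPaleySystem_of_gram_eq hn hr hψ hΨ hsmul
  obtain ⟨ω, hω⟩ := exists_generator (q := q)
  obtain ⟨π, hproj, hπ⟩ := hP.exists_projRep hω hn
  refine ⟨π, Ψ 1, hproj, fun hstrict => ?_, hP.norm_eq_one 1 one_ne_zero,
    SwitchingEquiv.trans ?_ hφ⟩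
  · obtain ⟨m, rfl⟩ : ∃ m, n = m + m := ⟨n / 2, by have := hq.out; omega⟩
    have hmm : (m : ZMod (m + m)) + m = 0 := by rw [← Nat.cast_add, ZMod.natCast_self]
    have hcomm : DihedralGroup.r (m : ZMod (m + m)) * DihedralGroup.sr 0 =
        DihedralGroup.sr 0 * DihedralGroup.r (m : ZMod (m + m)) := by
      rw [DihedralGroup.r_mul_sr, DihedralGroup.sr_mul_r, zero_sub, zero_add,
        neg_eq_of_add_eq_zero_left hmm]
    have h1 := hstrict.apply_comm hcomm (Ψ 1)
    have hneg : quadraticChar (ZMod q) (-1) = -1 := by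
      rw [quadraticChar_neg hq.out]; simp
    rw [hπ, hπ, hπ, hπ, dihedralMap_anticommute hω hn, hP.map_smul, hneg] at h1
    have hne := hP.norm_eq_one _ (dihedralMap_ne_zero ω (DihedralGroup.sr (0 : ZMod (m + m)))
      (dihedralMap_ne_zero ω (DihedralGroup.r (m : ZMod (m + m))) one_ne_zero))
    have h0 : Ψ (dihedralMap ω (DihedralGroup.sr (0 : ZMod (m + m)))
        (dihedralMap ω (DihedralGroup.r (m : ZMod (m + m))) 1)) = 0 := by
      push_cast at h1
      rw [neg_smul, one_smul] at h1
      have h3 := add_eq_zero_iff_eq_neg.2 h1.symm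
      rw [← two_smul ℂ (Ψ _)] at h3
      exact (smul_eq_zero.1 h3).resolve_left two_ne_zero
    rw [h0, norm_zero] at hne
    exact zero_ne_one hne
  · choose σ c hc0 hσ using fun g : DihedralGroup n =>
      hr.exists_eq_smul e _ (dihedralMap_ne_zero ω g one_ne_zero)
    have hinj : Function.Injective σ := by
      intro g g' hgg
      refine dihedralMap_one_injective hω hn (c := c g * (c g')⁻¹) ?_
      rw [hσ g, hσ g', hgg, smul_smul, inv_mul_cancel_right₀ (hc0 g')]
    have hbij : Function.Bijective σ := (Fintype.bijective_iff_injective_and_card σ).2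
      ⟨hinj, by rw [DihedralGroup.card, Fintype.card_fin, hn]⟩
    refine ⟨Equiv.ofBijective σ hbij, fun g => ((quadraticChar (ZMod q) (c g) : ℤ) : ℂ),
      LinearIsometryEquiv.refl ℂ _, fun g => ?_, fun g => ?_⟩
    · rcases quadraticChar_dichotomy (hc0 g) with h1 | h1 <;> simp [h1]
    · simp only [LinearIsometryEquiv.coe_refl, id, Equiv.ofBijective_apply]
      rw [hπ, hσ, hΨ, smul_smul, ← Int.cast_mul,
        quadraticChar_mul_self (hc0 g), Int.cast_one, one_smul]

end PaleyFrame

/-! ### Existence -/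

theorem exists_isPaleyETF {q n : ℕ} [Fact q.Prime] (hq : q % 4 = 3) (hn : q + 1 = 2 * n) :
    ∃ φ : Fin (q + 1) → E n, IsPaleyETF φ := by
  have e : Fin (q + 1) ≃ ProjLine q := (Finite.equivFinOfCardEq card_projLine).symm
  have hr : IsLift (fun P : ProjLine q => P.rep) := fun P => ⟨P.rep_nonzero, P.mk_rep⟩
  have hH := isSkewHadamard_paleyHadamard hq e hr
  obtain ⟨φ, hφ⟩ := exists_gram_eq (n := n) hH.isHermitian_skewGram
    (hH.skewGram_mul_self (by omega)) (by
      simp only [Matrix.trace, Matrix.diag_apply, hH.skewGram_self, Finset.sum_const,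
        Finset.card_univ, Fintype.card_fin, hn]
      simp)
  exact ⟨φ, e, _, φ, hr, hφ, Equiv.refl _, fun _ => 1, LinearIsometryEquiv.refl ℂ _,
    fun _ => by simp, fun _ => by simp⟩

end PaleyDihedral

theorem mainTheorem9 (q : ℕ) [Fact q.Prime] (hq : q % 4 = 3) :
    (∀ (e : Fin (q + 1) ≃ PaleyDihedral.ProjLine q)
        (r : PaleyDihedral.ProjLine q → PaleyDihedral.Plane q),
      PaleyDihedral.IsLift r →
        PaleyDihedral.IsSkewHadamard (PaleyDihedral.paleyHadamard e r)) ∧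
    (∃ φ : Fin (q + 1) → PaleyDihedral.E ((q + 1) / 2), PaleyDihedral.IsPaleyETF φ) ∧
    ∀ φ : Fin (q + 1) → PaleyDihedral.E ((q + 1) / 2), PaleyDihedral.IsPaleyETF φ →
      PaleyDihedral.IsETF φ ∧
      PaleyDihedral.IsGenuineProjectiveDihedral φ ∧
      ¬ PaleyDihedral.IsStrictDihedral φ := by
  have hn : q + 1 = 2 * ((q + 1) / 2) := by omega
  have h2 : 2 ≤ q + 1 := by omega
  refine ⟨fun e r hr => PaleyDihedral.isSkewHadamard_paleyHadamard hq e hr,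
    PaleyDihedral.exists_isPaleyETF hq hn, ?_⟩
  rintro φ ⟨e, r, ψ, hr, hψ, hφ⟩
  have hH := PaleyDihedral.isSkewHadamard_paleyHadamard hq e hr
  have : Fact (q % 4 = 3) := ⟨hq⟩
  have : NeZero ((q + 1) / 2) := ⟨by omega⟩
  exact ⟨hφ.isETF (PaleyDihedral.isETF_of_gram_eq hH hn h2 hψ),
    PaleyDihedral.isGenuineProjectiveDihedral_of_gram_eq hn hr hψ hφ,
    PaleyDihedral.not_isStrictDihedral_of_gram_eq hH h2 (Nat.even_iff.2 (by omega)) (by omega)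
      hψ hφ⟩
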